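/- A nonempty family $\mathcal J$ of subsets of $\mathbb R$ is called a proper linearly invariant (p.l.i.) $\sigma$-ideal if $\mathbb R\notin\mathcal J$, $\mathcal J$ is closed under countable unions and under passing to subsets, and $\alpha A+\beta\in\mathcal J$ whenever $A\in\mathcal J$, $\alpha\in\mathbb R\setminus\{0\}$, $\beta\in\mathbb R$. A property holds for $\mathcal J$-almost all $x\in S$ (where $S\subset\mathbb R$) if it holds for all $x\in S\setminus U$ for some $U\in\mathcal J$. For $M\subset\mathbb R^2$ and $x\in\mathbb R$ put $M[x]=\{y\in\mathbb R:(x,y)\in M\}$, and let $$\Omega(\mathcal J)=\{M\subset\mathbb R^2:\ M[x]\in\mathcal J\ \text{for }\mathcal J\text{-almost all }x\in\mathbb R\}.$$ A unimodular transformation of the plane is a map $T(x,y)=(px+qy,\,rx+sy)$ with $p,q,r,s\in\mathbb Z$ and $ps-qr=\pm1$. A function $A:(0,\infty)\to\mathbb R$ is additive if $A(x+y)=A(x)+A(y)$ for all $x,y>0$; a function $L:(0,\infty)\to\mathbb R$ is of logarithmic type if $L(xy)=L(x)+L(y)$ for all $x,y>0$. **Theorem.** Let $\mathcal J$ be a p.l.i.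 $\sigma$-ideal in $\mathbb R$, let $a,b,c,d:(0,\infty)\to\mathbb R$, and let $M\in\Omega(\mathcal J)$ be such that $$a(x)+b(y)=c(x+y)+d\left(\frac xy\right)\qquad\text{for all }(x,y)\in(0,\infty)^2\setminus M.$$ Suppose that $T(M)\in\Omega(\mathcal J)$ for every unimodular transformation $T$ of the plane. Then there exist an additive function $A:(0,\infty)\to\mathbb R$, logarithmic type functions $L_a,L_b:(0,\infty)\to\mathbb R$ and real constants $\alpha,\beta,\gamma$ such that $$a(x)=A(x)+L_a(x)+\alpha,\qquad b(x)=A(x)+L_b(x)+\beta,\qquad c(x)=A(x)+L_a(x)+L_b(x)+\gamma$$ and $$d(x)=L_a\left(\frac{x}{x+1}\right)-L_b(x+1)+\alpha+\beta-\gamma$$ for $\mathcal J$-almost all $x\in(0,\infty)$. -/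

import Mathlib

/-- A proper linearly invariant σ-ideal of subsets of the real line. -/
structure IsPLISigmaIdeal (J : Set (Set ℝ)) : Prop where
  nonempty : J.Nonempty
  proper : Set.univ ∉ J
  iUnion_mem : ∀ A : ℕ → Set ℝ, (∀ n, A n ∈ J) → (⋃ n, A n) ∈ J
  hereditary : ∀ A ∈ J, ∀ B : Set ℝ, B ⊆ A → B ∈ J
  affine_mem : ∀ A ∈ J, ∀ α β : ℝ, α ≠ 0 → (fun x : ℝ => α * x + β) '' A ∈ J

/-- The property `P` holds for `J`-almost all real `x`. -/
def AlmostAll (J : Set (Set ℝ)) (P : ℝ → Prop) : Prop :=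
  ∃ U ∈ J, ∀ x, x ∉ U → P x

/-- The section `M[x]`. -/
def planeSection (M : Set (ℝ × ℝ)) (x : ℝ) : Set ℝ :=
  {y | (x, y) ∈ M}

/-- The family `Ω(J)` of subsets of the plane. -/
def omegaFamily (J : Set (Set ℝ)) : Set (Set (ℝ × ℝ)) :=
  {M | AlmostAll J (fun x => planeSection M x ∈ J)}

/-- Unimodular transformations of the plane: linear maps given by an integer matrix
of determinant `1` or `-1`. -/
def IsUnimodular (T : ℝ × ℝ → ℝ × ℝ) : Prop :=
  ∃ p q r s : ℤ, (p * s - q * r = 1 ∨ p * s - q * r = -1) ∧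
    ∀ x y : ℝ, T (x, y) = ((p : ℝ) * x + q * y, (r : ℝ) * x + s * y)

/-- Additive functions on `(0, ∞)`; values at nonpositive arguments play no role. -/
def IsAdditiveOnPos (A : ℝ → ℝ) : Prop :=
  ∀ x y : ℝ, 0 < x → 0 < y → A (x + y) = A x + A y

/-- Logarithmic type functions on `(0, ∞)`; values at nonpositive arguments play no role. -/
def IsLogTypeOnPos (L : ℝ → ℝ) : Prop :=
  ∀ x y : ℝ, 0 < x → 0 < y → L (x * y) = L x + L y

/-! ### Null sets as a filter -/

open Filter

/-! Replacing `(x, y)` by `(r * x, r * y)` and subtracting cancels `d`, since `x / y` is unchanged.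
The increments `a (r * x) - a x`, and likewise for `b` and `c`, then solve a Pexider equation almost
everywhere, so each is a common additive `A r` plus a constant (`pexider_almost`). Composing
dilations makes the constants logarithmic in `r` and `A` a cocycle (`dilation_cocycle`); as
dilations commute, this cocycle is the coboundary of `A 2`. Subtracting `A 2` and the logarithmic
parts leaves a solution of the same equation with `a`, `b`, `c` dilation invariant almost
everywhere, and such a solution is constant (`all_const_of_dilation_invariant`). -/

/-- The filter of sets whose complement belongs to the ideal. -/
def IsPLISigmaIdeal.dualFilter {J : Set (Set ℝ)} (hJ : IsPLISigmaIdeal J) : Filter ℝ where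
  sets := {S | Sᶜ ∈ J}
  univ_sets := by
    obtain ⟨A, hA⟩ := hJ.nonempty
    exact hJ.hereditary A hA _ (by simp)
  sets_of_superset := fun {S T} hS hST =>
    hJ.hereditary _ hS _ (Set.compl_subset_compl.mpr hST)
  inter_sets := fun {S T} hS hT => by
    have h := hJ.iUnion_mem (fun n => if n = 0 then Sᶜ else Tᶜ)
      (fun n => by by_cases hn : n = 0 <;> simpa [hn] using (by assumption))
    refine hJ.hereditary _ h _ ?_
    intro x hx
    rw [Set.mem_iUnion]
    by_cases hxS : x ∈ S
    · exact ⟨1, by simpa using fun hxT => hx ⟨hxS, hxT⟩⟩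
    · exact ⟨0, by simpa using hxS⟩

theorem IsPLISigmaIdeal.mem_dualFilter {J : Set (Set ℝ)} (hJ : IsPLISigmaIdeal J) {S : Set ℝ} :
    S ∈ hJ.dualFilter ↔ Sᶜ ∈ J := Iff.rfl

theorem IsPLISigmaIdeal.almostAll_iff {J : Set (Set ℝ)} (hJ : IsPLISigmaIdeal J) {P : ℝ → Prop} :
    AlmostAll J P ↔ ∀ᶠ x in hJ.dualFilter, P x := by
  constructor
  · rintro ⟨U, hU, h⟩
    exact hJ.hereditary U hU _ fun x hx => by_contra fun hxU => hx (h x hxU)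
  · intro h
    exact ⟨_, h, fun x hx => not_not.mp hx⟩

/-- A filter on the line stable under affine maps, for which no interval `(0, u)` is negligible. -/
structure IsAffineFilter (F : Filter ℝ) : Prop where
  tendsto : ∀ α β : ℝ, α ≠ 0 → Tendsto (fun x => α * x + β) F F
  frequently : ∀ u : ℝ, 0 < u → ∃ᶠ x in F, 0 < x ∧ x < u

theorem IsPLISigmaIdeal.isAffineFilter {J : Set (Set ℝ)} (hJ : IsPLISigmaIdeal J) :
    IsAffineFilter hJ.dualFilter := by
  have ht : ∀ α β : ℝ, α ≠ 0 →
      Tendsto (fun x => α * x + β) hJ.dualFilter hJ.dualFilter := by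
    intro α β hα S hS
    have h := hJ.affine_mem _ hS α⁻¹ (-(α⁻¹ * β)) (inv_ne_zero hα)
    refine hJ.hereditary _ h _ ?_
    intro x hx
    exact ⟨α * x + β, hx, by field_simp; ring⟩
  refine ⟨ht, fun u hu h => ?_⟩
  have hn : ∀ n : ℤ, {x : ℝ | ¬ (0 < x + n * (u / 2) ∧ x + n * (u / 2) < u)}ᶜ ∈ J := by
    intro n
    have := (ht 1 (n * (u / 2)) one_ne_zero).eventually h
    simp only [one_mul] at this
    exact this
  obtain ⟨e⟩ : Nonempty (ℕ ≃ ℤ) := ⟨(Denumerable.eqv ℤ).symm⟩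
  have hU := hJ.iUnion_mem _ (fun k => hn (e k))
  refine hJ.proper (hJ.hereditary _ hU _ fun x _ => ?_)
  rw [Set.mem_iUnion]
  -- This shift moves `x` into `(0, u / 2]`. Steps of `u / 2` are used because translates of the
  -- open interval by multiples of `u` miss the endpoints.
  refine ⟨e.symm (1 - ⌈x / (u / 2)⌉), ?_⟩
  have h1 := Int.le_ceil (x / (u / 2))
  have h2 := Int.ceil_lt_add_one (x / (u / 2))
  rw [div_le_iff₀ (by positivity)] at h1
  have h3 : (⌈x / (u / 2)⌉ : ℝ) * (u / 2) < x + u / 2 := by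
    have := mul_lt_mul_of_pos_right h2 (show 0 < u / 2 by positivity)
    have e1 : (x / (u / 2) + 1) * (u / 2) = x + u / 2 := by field_simp
    linarith
  simp only [Equiv.apply_symm_apply, Set.mem_compl_iff, Set.mem_ofPred_eq, not_not]
  push_cast
  constructor <;> nlinarith

namespace IsAffineFilter

variable {F : Filter ℝ}

theorem comp_affine (hF : IsAffineFilter F) {P : ℝ → Prop} (h : ∀ᶠ x in F, P x) (α β : ℝ)
    (hα : α ≠ 0) : ∀ᶠ x in F, P (α * x + β) :=
  (hF.tendsto α β hα).eventually h

theorem comp_mul (hF : IsAffineFilter F) {P : ℝ → Prop} (h : ∀ᶠ x in F, P x) {α : ℝ}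
    (hα : 0 < α) : ∀ᶠ x in F, P (α * x) := by
  simpa using hF.comp_affine h α 0 hα.ne'

theorem comp_add (hF : IsAffineFilter F) {P : ℝ → Prop} (h : ∀ᶠ x in F, P x) (β : ℝ) :
    ∀ᶠ x in F, P (x + β) := by
  simpa using hF.comp_affine h 1 β one_ne_zero

theorem comp_sub (hF : IsAffineFilter F) {P : ℝ → Prop} (h : ∀ᶠ x in F, P x) (u : ℝ) :
    ∀ᶠ x in F, P (u - x) := by
  have := hF.comp_affine h (-1) u (by norm_num)
  filter_upwards [this] with x hx
  rwa [show -1 * x + u = u - x by ring] at hx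

theorem exists_Ioo (hF : IsAffineFilter F) {P : ℝ → Prop} (h : ∀ᶠ x in F, P x) {u : ℝ}
    (hu : 0 < u) : ∃ x, 0 < x ∧ x < u ∧ P x := by
  obtain ⟨x, hx, hP⟩ := ((hF.frequently u hu).and_eventually h).exists
  exact ⟨x, hx.1, hx.2, hP⟩

theorem exists_gt (hF : IsAffineFilter F) {P : ℝ → Prop} (h : ∀ᶠ x in F, P x) (K : ℝ) :
    ∃ x, K < x ∧ P x := by
  obtain ⟨x, hx, -, hP⟩ := hF.exists_Ioo (hF.comp_add h K) one_pos
  exact ⟨x + K, by linarith, hP⟩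

/-- An additive function which is constant almost everywhere on the half-line vanishes. -/
theorem additive_eq_zero (hF : IsAffineFilter F) {D : ℝ → ℝ} (hD : ∀ x y, D (x + y) = D x + D y)
    {k : ℝ} (h : ∀ᶠ x in F, 0 < x → D x = k) : k = 0 ∧ ∀ x, D x = 0 := by
  have hk : k = 0 := by
    obtain ⟨x, hx, h1, h2⟩ := hF.exists_gt (h.and (hF.comp_mul h two_pos)) 0
    have h3 := hD x x
    rw [← two_mul, h2 (by positivity), h1 hx] at h3
    linarith
  refine ⟨hk, fun z => ?_⟩
  obtain ⟨x, hx, h1, h2⟩ := hF.exists_gt (h.and (hF.comp_add h z)) (max 0 (-z))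
  have := hD x z
  rw [h1 (by linarith [le_max_left 0 (-z)]), h2 (by linarith [le_max_right 0 (-z)])] at this
  linarith

end IsAffineFilter

/-! ### Almost everywhere in the plane -/

/-- A relation on the plane holds almost everywhere along vertical, horizontal and antidiagonal
lines. -/
structure AlmostAllPlane (F : Filter ℝ) (P : ℝ → ℝ → Prop) : Prop where
  vert : ∀ᶠ x in F, ∀ᶠ y in F, P x y
  horiz : ∀ᶠ y in F, ∀ᶠ x in F, P x y
  diag : ∀ᶠ u in F, ∀ᶠ x in F, P x (u - x)

namespace AlmostAllPlane

variable {F : Filter ℝ} {P Q : ℝ → ℝ → Prop}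

theorem swap (hF : IsAffineFilter F) (h : AlmostAllPlane F P) :
    AlmostAllPlane F (fun x y => P y x) := by
  refine ⟨h.horiz, h.vert, ?_⟩
  filter_upwards [h.diag] with u hu
  filter_upwards [hF.comp_sub hu u] with x hx
  simpa using hx

theorem and (h : AlmostAllPlane F P) (h' : AlmostAllPlane F Q) :
    AlmostAllPlane F (fun x y => P x y ∧ Q x y) := by
  refine ⟨?_, ?_, ?_⟩
  · filter_upwards [h.vert, h'.vert] with x h1 h2 using h1.and h2
  · filter_upwards [h.horiz, h'.horiz] with x h1 h2 using h1.and h2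
  · filter_upwards [h.diag, h'.diag] with x h1 h2 using h1.and h2

theorem mono (h : AlmostAllPlane F P) (hPQ : ∀ x y, P x y → Q x y) : AlmostAllPlane F Q := by
  refine ⟨?_, ?_, ?_⟩
  · filter_upwards [h.vert] with x h1 using h1.mono fun _ => hPQ _ _
  · filter_upwards [h.horiz] with x h1 using h1.mono fun _ => hPQ _ _
  · filter_upwards [h.diag] with x h1 using h1.mono fun _ => hPQ _ _

theorem scale (hF : IsAffineFilter F) (h : AlmostAllPlane F P) {r : ℝ} (hr : 0 < r) :
    AlmostAllPlane F (fun x y => P (r * x) (r * y)) := by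
  refine ⟨?_, ?_, ?_⟩
  · filter_upwards [hF.comp_mul h.vert hr] with x hx using hF.comp_mul hx hr
  · filter_upwards [hF.comp_mul h.horiz hr] with x hx using hF.comp_mul hx hr
  · filter_upwards [hF.comp_mul h.diag hr] with x hx
    filter_upwards [hF.comp_mul hx hr] with y hy
    rwa [mul_sub]

end AlmostAllPlane

/-! ### The Pexider equation almost everywhere -/

section Pexider

variable {F : Filter ℝ} {f g h : ℝ → ℝ}

/-- The increments of `h` are almost everywhere given by an additive function, and `g` is this
function up to a constant. -/
theorem exists_additive_increment (hF : IsAffineFilter F)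
    (H : AlmostAllPlane F fun x y => 0 < x → 0 < y → f x + g y = h (x + y)) :
    ∃ A : ℝ → ℝ, (∀ x y, A (x + y) = A x + A y) ∧
      (∀ z, ∃ K, ∀ᶠ x in F, K < x → h (x + z) - h x = A z) ∧
      ∃ β, ∀ᶠ y in F, 0 < y → g y = A y + β := by
  -- Comparing two good horizontal lines eliminates `f`.
  have key : ∀ y₁ y₂, 0 < y₁ → 0 < y₂ →
      (∀ᶠ x in F, 0 < x → 0 < y₁ → f x + g y₁ = h (x + y₁)) →
      (∀ᶠ x in F, 0 < x → 0 < y₂ → f x + g y₂ = h (x + y₂)) →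
      ∀ᶠ x in F, y₂ < x → h (x + (y₁ - y₂)) - h x = g y₁ - g y₂ := by
    intro y₁ y₂ p₁ p₂ h₁ h₂
    filter_upwards [hF.comp_add h₁ (-y₂), hF.comp_add h₂ (-y₂)] with x e₁ e₂ hx
    have e₁ := e₁ (by linarith) p₁
    have e₂ := e₂ (by linarith) p₂
    rw [show x + -y₂ + y₁ = x + (y₁ - y₂) by ring] at e₁
    rw [show x + -y₂ + y₂ = x by ring] at e₂
    linarith
  have ex : ∀ z, ∃ v K, ∀ᶠ x in F, K < x → h (x + z) - h x = v := by
    intro z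
    obtain ⟨y, hy, h₁, h₂⟩ := hF.exists_gt (H.horiz.and (hF.comp_add H.horiz z)) (max 0 (-z))
    have hy0 : 0 < y := by linarith [le_max_left 0 (-z)]
    have hyz : 0 < y + z := by linarith [le_max_right 0 (-z)]
    have := key (y + z) y hyz hy0 h₂ h₁
    rw [add_sub_cancel_left] at this
    exact ⟨_, _, this⟩
  choose A hA using ex
  have uniq : ∀ z v K, (∀ᶠ x in F, K < x → h (x + z) - h x = v) → v = A z := by
    intro z v K hv
    obtain ⟨K', hK'⟩ := hA z
    obtain ⟨x, hx, h₁, h₂⟩ := hF.exists_gt (hv.and hK') (max K K')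
    rw [← h₁ ((le_max_left _ _).trans_lt hx), h₂ ((le_max_right _ _).trans_lt hx)]
  have add : ∀ x y, A (x + y) = A x + A y := by
    intro z w
    obtain ⟨K, hK⟩ := hA z
    obtain ⟨K', hK'⟩ := hA w
    refine (uniq (z + w) _ (max K (K' - z)) ?_).symm
    filter_upwards [hK, hF.comp_add hK' z] with x h₁ h₂ hx
    have e₁ := h₁ ((le_max_left _ _).trans_lt hx)
    have e₂ := h₂ (by linarith [le_max_right K (K' - z)])
    rw [← add_assoc]
    linarith
  refine ⟨A, add, hA, ?_⟩
  obtain ⟨y₀, p₀, h₀⟩ := hF.exists_gt H.horiz 0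
  refine ⟨g y₀ - A y₀, ?_⟩
  filter_upwards [H.horiz] with y hy p
  have e := uniq _ _ _ (key y y₀ p p₀ hy h₀)
  have e' := add (y - y₀) y₀
  rw [sub_add_cancel] at e'
  linarith

/-- Solutions of the Pexider equation almost everywhere on the half-line. -/
theorem pexider_almost (hF : IsAffineFilter F)
    (H : AlmostAllPlane F fun x y => 0 < x → 0 < y → f x + g y = h (x + y)) :
    ∃ (A : ℝ → ℝ) (α β : ℝ), (∀ x y, A (x + y) = A x + A y) ∧
      (∀ᶠ x in F, 0 < x → f x = A x + α) ∧ (∀ᶠ x in F, 0 < x → g x = A x + β) ∧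
      ∀ᶠ x in F, 0 < x → h x = A x + α + β := by
  obtain ⟨A, hA, hAh, β, hβ⟩ := exists_additive_increment hF H
  have H' : AlmostAllPlane F fun x y => 0 < x → 0 < y → g x + f y = h (x + y) := by
    refine (H.swap hF).mono fun x y e hx hy => ?_
    rw [add_comm (g x), add_comm x]
    exact e hy hx
  obtain ⟨B, -, hBh, α, hα⟩ := exists_additive_increment hF H'
  have hBA : B = A := by
    funext z
    obtain ⟨K, hK⟩ := hAh z
    obtain ⟨K', hK'⟩ := hBh z
    obtain ⟨x, hx, h₁, h₂⟩ := hF.exists_gt (hK.and hK') (max K K')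
    rw [← h₁ ((le_max_left _ _).trans_lt hx), h₂ ((le_max_right _ _).trans_lt hx)]
  subst hBA
  refine ⟨B, α, β, hA, hα, hβ, ?_⟩
  -- On a good antidiagonal, one point where `f` and `g` have their known form determines `h u`.
  filter_upwards [H.diag] with u hu hu0
  obtain ⟨x, hx, hxu, e, e₁, e₂⟩ := hF.exists_Ioo (hu.and (hα.and (hF.comp_sub hβ u))) hu0
  have e := e hx (by linarith)
  rw [e₁ hx, e₂ (by linarith), add_sub_cancel] at e
  have := hA x (u - x)
  rw [add_sub_cancel] at this
  linarith

end Pexider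

/-! ### The Olkin–Baker equation almost everywhere -/

section OlkinBaker

variable {F : Filter ℝ} {a b c d : ℝ → ℝ}

/-- If `a`, `b`, `c` are almost everywhere invariant under each dilation, then `b` is constant. -/
theorem const_of_dilation_invariant (hF : IsAffineFilter F)
    (H : AlmostAllPlane F fun x y => 0 < x → 0 < y → a x + b y = c (x + y) + d (x / y))
    (ha : ∀ r, 0 < r → ∀ᶠ x in F, 0 < x → a (r * x) = a x)
    (hc : ∀ r, 0 < r → ∀ᶠ x in F, 0 < x → c (r * x) = c x) :
    ∃ β, ∀ᶠ y in F, 0 < y → b y = β := by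
  have key : ∀ y, 0 < y →
      (∀ᶠ x in F, 0 < x → 0 < y → a x + b y = c (x + y) + d (x / y)) →
      ∀ᶠ t in F, 0 < t → b y = c (t + 1) + d t - a t := by
    intro y hy h
    -- With `x = y * t`, invariance under dilation by `y` leaves a right side free of `y`.
    filter_upwards [hF.comp_mul h hy, ha y hy, hF.comp_add (hc y hy) 1] with t e e₁ e₂ ht
    have e := e (by positivity) hy
    rw [e₁ ht, mul_div_cancel_left₀ _ hy.ne', show y * t + y = y * (t + 1) by ring,
      e₂ (by linarith)] at e
    linarith
  obtain ⟨y₀, p₀, h₀⟩ := hF.exists_gt H.horiz 0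
  refine ⟨b y₀, ?_⟩
  filter_upwards [H.horiz] with y hy p
  obtain ⟨t, ht, e₁, e₂⟩ := hF.exists_gt ((key y p hy).and (key y₀ p₀ h₀)) 0
  rw [e₁ ht, e₂ ht]

/-- Once `a` and `b` are constant, putting `x = u * s` on the antidiagonal `x + y = u` expresses `c
u` through `s` alone, so two good values of `u` can be compared at a common `s`. One good horizontal
line then gives `d`. -/
theorem all_const_of_dilation_invariant (hF : IsAffineFilter F)
    (H : AlmostAllPlane F fun x y => 0 < x → 0 < y → a x + b y = c (x + y) + d (x / y))
    (ha : ∀ r, 0 < r → ∀ᶠ x in F, 0 < x → a (r * x) = a x)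
    (hb : ∀ r, 0 < r → ∀ᶠ x in F, 0 < x → b (r * x) = b x)
    (hc : ∀ r, 0 < r → ∀ᶠ x in F, 0 < x → c (r * x) = c x) :
    ∃ α β γ, ∀ᶠ x in F, 0 < x → a x = α ∧ b x = β ∧ c x = γ ∧ d x = α + β - γ := by
  obtain ⟨β, hβ⟩ := const_of_dilation_invariant hF H ha hc
  obtain ⟨α, hα⟩ : ∃ α, ∀ᶠ y in F, 0 < y → a y = α := by
    refine const_of_dilation_invariant (d := fun t => d t⁻¹) (a := b) (c := c) hF ?_ hb hc
    refine (H.swap hF).mono fun x y e hx hy => ?_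
    have e := e hy hx
    rw [inv_div, add_comm (b x), add_comm x]
    exact e
  have key : ∀ u, 0 < u →
      (∀ᶠ x in F, 0 < x → 0 < u - x → a x + b (u - x) = c (x + (u - x)) + d (x / (u - x))) →
      ∀ᶠ s in F, 0 < s → s < 1 → c u = α + β - d (s / (1 - s)) := by
    intro u hu h
    filter_upwards [hF.comp_mul (h.and (hα.and (hF.comp_sub hβ u))) hu] with s hs h0 h1
    obtain ⟨e, e₁, e₂⟩ := hs
    have p : 0 < u * s := by positivity
    have q : 0 < u - u * s := by nlinarith
    have e := e p q
    rw [e₁ p, e₂ q, add_sub_cancel, show u - u * s = u * (1 - s) by ring,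
      mul_div_mul_left _ _ hu.ne'] at e
    linarith
  obtain ⟨u₀, p₀, h₀⟩ := hF.exists_gt H.diag 0
  have hγ : ∀ᶠ u in F, 0 < u → c u = c u₀ := by
    filter_upwards [H.diag] with u hu p
    obtain ⟨s, h0, h1, e₁, e₂⟩ := hF.exists_Ioo ((key u p hu).and (key u₀ p₀ h₀)) one_pos
    rw [e₁ h0 h1, e₂ h0 h1]
  have hδ : ∀ᶠ t in F, 0 < t → d t = α + β - c u₀ := by
    obtain ⟨y, hy, h, hby⟩ := hF.exists_gt (H.horiz.and hβ) 0
    filter_upwards [hF.comp_mul (h.and (hα.and (hF.comp_add hγ y))) hy] with t ht h0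
    obtain ⟨e, e₁, e₂⟩ := ht
    have p : 0 < y * t := by positivity
    have e := e p hy
    rw [e₁ p, hby hy, e₂ (by linarith), mul_div_cancel_left₀ _ hy.ne'] at e
    linarith
  refine ⟨α, β, c u₀, ?_⟩
  filter_upwards [hα, hβ, hγ, hδ] with x h1 h2 h3 h4 hx using ⟨h1 hx, h2 hx, h3 hx, h4 hx⟩

/-- If every dilation increment of `f` is almost everywhere an additive function plus a constant,
then these additive functions and constants satisfy the cocycle identities. -/
theorem dilation_cocycle (hF : IsAffineFilter F) {f : ℝ → ℝ} {A : ℝ → ℝ → ℝ} {L : ℝ → ℝ}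
    (hA : ∀ r, 0 < r → ∀ x y, A r (x + y) = A r x + A r y)
    (h : ∀ r, 0 < r → ∀ᶠ x in F, 0 < x → f (r * x) - f x = A r x + L r)
    {r s : ℝ} (hr : 0 < r) (hs : 0 < s) :
    L (r * s) = L r + L s ∧ ∀ x, A (r * s) x = A r (s * x) + A s x := by
  -- Computing the increment under `r * s` in two ways shows that this additive defect is almost
  -- everywhere constant, hence zero.
  have key := hF.additive_eq_zero (D := fun x => A (r * s) x - A r (s * x) - A s x)
    (k := L r + L s - L (r * s))
    (fun x y => by
      simp only [mul_add, hA r hr, hA s hs, hA (r * s) (mul_pos hr hs)]; ring) ?_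
  · refine ⟨by linarith [key.1], fun x => by have := key.2 x; linarith⟩
  · filter_upwards [h _ (mul_pos hr hs), hF.comp_mul (h r hr) hs, h s hs] with x e₁ e₂ e₃ hx
    have e₁ := e₁ hx
    have e₂ := e₂ (by positivity)
    have e₃ := e₃ hx
    rw [← mul_assoc] at e₂
    linarith

theorem olkinBaker_almost (hF : IsAffineFilter F)
    (H : AlmostAllPlane F fun x y => 0 < x → 0 < y → a x + b y = c (x + y) + d (x / y)) :
    ∃ A La Lb : ℝ → ℝ, (∀ x y, A (x + y) = A x + A y) ∧
      IsLogTypeOnPos La ∧ IsLogTypeOnPos Lb ∧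
      ∃ α β γ : ℝ, ∀ᶠ x in F, 0 < x →
        a x = A x + La x + α ∧ b x = A x + Lb x + β ∧ c x = A x + La x + Lb x + γ ∧
        d x = La (x / (x + 1)) - Lb (x + 1) + α + β - γ := by
  have hex : ∀ r : ℝ, ∃ (A : ℝ → ℝ) (α β : ℝ), 0 < r → (∀ x y, A (x + y) = A x + A y) ∧
      (∀ᶠ x in F, 0 < x → a (r * x) - a x = A x + α) ∧
      (∀ᶠ x in F, 0 < x → b (r * x) - b x = A x + β) ∧
      ∀ᶠ x in F, 0 < x → c (r * x) - c x = A x + (α + β) := by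
    intro r
    by_cases hr : 0 < r
    · obtain ⟨A, α, β, hA, h1, h2, h3⟩ := pexider_almost (f := fun x => a (r * x) - a x)
        (g := fun x => b (r * x) - b x) (h := fun x => c (r * x) - c x) hF
        ((H.and (H.scale hF hr)).mono fun x y e hx hy => by
          have e₁ := e.1 hx hy
          have e₂ := e.2 (by positivity) (by positivity)
          rw [← mul_add, mul_div_mul_left _ _ hr.ne'] at e₂
          linarith)
      exact ⟨A, α, β, fun _ => ⟨hA, h1, h2, by simpa only [add_assoc] using h3⟩⟩
    · exact ⟨0, 0, 0, fun h => absurd h hr⟩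
  choose A La Lb hex using hex
  have hadd : ∀ r, 0 < r → ∀ x y, A r (x + y) = A r x + A r y := fun r hr => (hex r hr).1
  have cocA := fun {r s : ℝ} => dilation_cocycle (r := r) (s := s) hF hadd
    fun r hr => (hex r hr).2.1
  have cocB := fun {r s : ℝ} => dilation_cocycle (r := r) (s := s) hF hadd
    fun r hr => (hex r hr).2.2.1
  have hLa : IsLogTypeOnPos La := fun x y hx hy => (cocA hx hy).1
  have hLb : IsLogTypeOnPos Lb := fun x y hx hy => (cocB hx hy).1
  -- Expand `A (2 * r)` in both orders. The choice of 2 makes `A r (2 * x) - A r x` equal to `A r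
  -- x`.
  have hAr : ∀ r, 0 < r → ∀ x, A r x = A 2 (r * x) - A 2 x := by
    intro r hr x
    have e₁ := (cocA hr two_pos).2 x
    have e₂ := (cocA two_pos hr).2 x
    rw [mul_comm r 2, two_mul x, hadd r hr] at e₁
    linarith
  have hA2 := hadd 2 two_pos
  have inv : ∀ (f L : ℝ → ℝ), IsLogTypeOnPos L →
      (∀ r, 0 < r → ∀ᶠ x in F, 0 < x → f (r * x) - f x = A r x + L r) →
      ∀ r, 0 < r → ∀ᶠ x in F, 0 < x →
        f (r * x) - A 2 (r * x) - L (r * x) = f x - A 2 x - L x := by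
    intro f L hL h r hr
    filter_upwards [h r hr] with x e hx
    have e := e hx
    rw [hAr r hr] at e
    rw [hL r x hr hx]
    linarith
  obtain ⟨α, β, γ, hfin⟩ := all_const_of_dilation_invariant
    (a := fun x => a x - A 2 x - La x) (b := fun x => b x - A 2 x - Lb x)
    (c := fun x => c x - A 2 x - (La x + Lb x))
    (d := fun t => d t - La (t / (t + 1)) + Lb (t + 1)) hF
    (H.mono fun x y e hx hy => by
      have e := e hx hy
      -- With `t = x / y`, use `x = t / (t + 1) * (x + y)` and `x + y = (t + 1) * y`.
      have e₁ := hLa (x / y / (x / y + 1)) (x + y) (by positivity) (by positivity)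
      have e₂ := hLb (x / y + 1) y (by positivity) hy
      rw [show x / y / (x / y + 1) * (x + y) = x by field_simp] at e₁
      rw [show (x / y + 1) * y = x + y by field_simp] at e₂
      have := hA2 x y
      linarith)
    (inv a La hLa fun r hr => (hex r hr).2.1) (inv b Lb hLb fun r hr => (hex r hr).2.2.1)
    (inv c (fun x => La x + Lb x)
      (fun x y hx hy => by simp only [hLa x y hx hy, hLb x y hx hy]; ring)
      fun r hr => (hex r hr).2.2.2)
  refine ⟨A 2, La, Lb, hA2, hLa, hLb, α, β, γ, ?_⟩
  filter_upwards [hfin] with x h hx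
  obtain ⟨h1, h2, h3, h4⟩ := h hx
  refine ⟨?_, ?_, ?_, ?_⟩ <;> linarith

end OlkinBaker

/-! ### From the ideal to the filter -/

theorem IsPLISigmaIdeal.mem_omegaFamily {J : Set (Set ℝ)} (hJ : IsPLISigmaIdeal J)
    {M : Set (ℝ × ℝ)} :
    M ∈ omegaFamily J ↔ ∀ᶠ x in hJ.dualFilter, ∀ᶠ y in hJ.dualFilter, (x, y) ∉ M := by
  refine hJ.almostAll_iff.trans (eventually_congr (Eventually.of_forall fun x => ?_))
  rw [Filter.Eventually, hJ.mem_dualFilter]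
  simp [planeSection, Set.compl_ofPred]

/-- Two unimodular maps suffice: the coordinate swap turns horizontal lines into vertical ones, and
`(x, y) ↦ (x + y, x)` does so for antidiagonals. -/
theorem IsPLISigmaIdeal.almostAllPlane {J : Set (Set ℝ)} (hJ : IsPLISigmaIdeal J)
    {M : Set (ℝ × ℝ)} (hM : M ∈ omegaFamily J)
    (hT : ∀ T : ℝ × ℝ → ℝ × ℝ, IsUnimodular T → T '' M ∈ omegaFamily J) :
    AlmostAllPlane hJ.dualFilter fun x y => (x, y) ∉ M := by
  refine ⟨hJ.mem_omegaFamily.mp hM, ?_, ?_⟩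
  · have h := hJ.mem_omegaFamily.mp (hT (fun p => (p.2, p.1))
      ⟨0, 1, 1, 0, by norm_num, fun x y => by simp⟩)
    filter_upwards [h] with y hy
    filter_upwards [hy] with x hx hM
    exact hx ⟨(x, y), hM, rfl⟩
  · have h := hJ.mem_omegaFamily.mp (hT (fun p => (p.1 + p.2, p.1))
      ⟨1, 1, 1, 0, by norm_num, fun x y => by simp⟩)
    filter_upwards [h] with u hu
    filter_upwards [hu] with x hx hM
    exact hx ⟨(x, u - x), hM, by simp⟩

theorem mainTheorem5 (J : Set (Set ℝ)) (hJ : IsPLISigmaIdeal J)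
    (a b c d : ℝ → ℝ) (M : Set (ℝ × ℝ)) (hM : M ∈ omegaFamily J)
    (hT : ∀ T : ℝ × ℝ → ℝ × ℝ, IsUnimodular T → T '' M ∈ omegaFamily J)
    (heq : ∀ x y : ℝ, 0 < x → 0 < y → (x, y) ∉ M → a x + b y = c (x + y) + d (x / y)) :
    ∃ A La Lb : ℝ → ℝ, IsAdditiveOnPos A ∧ IsLogTypeOnPos La ∧ IsLogTypeOnPos Lb ∧
      ∃ α β γ : ℝ, AlmostAll J (fun x => 0 < x →
        a x = A x + La x + α ∧
        b x = A x + Lb x + β ∧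
        c x = A x + La x + Lb x + γ ∧
        d x = La (x / (x + 1)) - Lb (x + 1) + α + β - γ) := by
  obtain ⟨A, La, Lb, hA, hLa, hLb, α, β, γ, h⟩ := olkinBaker_almost hJ.isAffineFilter
    ((hJ.almostAllPlane hM hT).mono fun x y hxy hx hy => heq x y hx hy hxy)
  exact ⟨A, La, Lb, fun x y _ _ => hA x y, hLa, hLb, α, β, γ, hJ.almostAll_iff.mpr h⟩
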